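/- Let $n\ge 2$ and $1\le p\le n-1$ be integers and put $N:=\binom{n}{p}$. Let $\mathcal{I}_{n,p}$ be the set of the $N$ integer tuples $(i_1,\ldots,i_p)$ with $1\le i_1<\cdots<i_p\le n$. Identify $\bigwedge^p\mathbb{R}^n$ with $\mathbb{R}^N$ so that the vectors $\mathbf{e}_{i_1}\wedge\cdots\wedge\mathbf{e}_{i_p}$, $(i_1,\ldots,i_p)\in\mathcal{I}_{n,p}$, form the standard basis of $\mathbb{R}^N$, where $\mathbf{e}_1,\ldots,\mathbf{e}_n$ is the standard basis of $\mathbb{R}^n$. A symmetric convex body in $\mathbb{R}^m$ is a compact convex set with nonempty interior that is symmetric about $\mathbf{0}$; a lattice in $\mathbb{R}^m$ is the set of integer linear combinations of a basis of $\mathbb{R}^m$. The $i$-th successive minimum $\lambda_i(\mathcal{B},M)$ $(1\le i\le m)$ of a symmetric convex body $\mathcal{B}$ with respect to a lattice $M$ in $\mathbb{R}^m$ is the smallest $\lambda\ge 0$ such that $\lambda\mathcal{B}\cap M$ contains $i$ linearly independent points. Let $\mathcal{C}$ be a symmetric convex body and $\Lambda$ a lattice in $\mathbb{R}^n$. Let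 the $p$-th compound $\mathcal{C}_p\subset\mathbb{R}^N$ be the convex hull of the points $\mathbf{x}_1\wedge\cdots\wedge\mathbf{x}_p$ with $\mathbf{x}_1,\ldots,\mathbf{x}_p\in\mathcal{C}$, and let the $p$-th compound $\Lambda_p$ be the lattice in $\mathbb{R}^N$ generated by the points $\mathbf{x}_1\wedge\cdots\wedge\mathbf{x}_p$ with $\mathbf{x}_1,\ldots,\mathbf{x}_p\in\Lambda$. Let $\mu_1\le\cdots\le\mu_N$ be the products $\lambda_{i_1}(\mathcal{C},\Lambda)\cdots\lambda_{i_p}(\mathcal{C},\Lambda)$, $(i_1,\ldots,i_p)\in\mathcal{I}_{n,p}$, arranged in non-decreasing order (with multiplicity). Then $$c_3(n,p)\le\frac{\lambda_i(\mathcal{C}_p,\Lambda_p)}{\mu_i}\le c_4(n,p)\qquad\text{for } i=1,\ldots,N,$$ where $c_3(n,p)$ and $c_4(n,p)$ are positive numbers depending only on $n$ and $p$. -/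

import Mathlib

open scoped Pointwise

/-- A symmetric convex body in a real normed space: a compact convex set with nonempty interior
that is symmetric about the origin. -/
structure IsSymmConvexBody {E : Type*} [NormedAddCommGroup E] [NormedSpace ℝ E]
    (C : Set E) : Prop where
  convex : Convex ℝ C
  isCompact : IsCompact C
  neg_mem : ∀ x ∈ C, -x ∈ C
  interior_nonempty : (interior C).Nonempty

/-- The `i`-th successive minimum (`i = 1, 2, …`) of `C` with respect to `Λ`: the smallest `r ≥ 0`
such that `r • C ∩ Λ` contains `i` linearly independent points. -/
noncomputable def successiveMinimum {E : Type*} [AddCommGroup E] [Module ℝ E]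
    (C : Set E) (Λ : Submodule ℤ E) (i : ℕ) : ℝ :=
  sInf {r : ℝ | 0 ≤ r ∧ ∃ v : Fin i → E, LinearIndependent ℝ v ∧ ∀ j, v j ∈ r • C ∧ v j ∈ Λ}

/-- The index set of the strictly increasing `p`-tuples `i₁ < ⋯ < i_p` with entries in an
`n`-element chain, encoded by their sets of entries. It has `n.choose p` elements. -/
abbrev IncTuple (n p : ℕ) : Type := Set.powersetCard (Fin n) p

/-- The exterior product `(x₁, …, x_p) ↦ x₁ ∧ ⋯ ∧ x_p` from `(ℝⁿ)^p` to `ℝ^N`, `N = n.choose p`: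
the coordinates of `ℝ^N` are labelled by the tuples `i₁ < ⋯ < i_p`, and `e_{i₁} ∧ ⋯ ∧ e_{i_p}` is
the standard basis vector with label `(i₁, …, i_p)` (see `wedge_basis`). -/
noncomputable def wedge (n p : ℕ) :
    EuclideanSpace ℝ (Fin n) [⋀^Fin p]→ₗ[ℝ] EuclideanSpace ℝ (IncTuple n p) :=
  (((EuclideanSpace.basisFun (Fin n) ℝ).toBasis.exteriorPower p).equivFun.trans
    (WithLp.linearEquiv 2 ℝ (IncTuple n p → ℝ)).symm).toLinearMap.compAlternatingMap
      (exteriorPower.ιMulti ℝ p)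

theorem wedge_basis (n p : ℕ) (s : IncTuple n p) :
    wedge n p (fun j => EuclideanSpace.single (Set.powersetCard.ofFinEmbEquiv.symm s j) (1 : ℝ)) =
      EuclideanSpace.single s 1 := by
  have h : (exteriorPower.ιMulti ℝ p)
      (fun j => EuclideanSpace.single (Set.powersetCard.ofFinEmbEquiv.symm s j) (1 : ℝ)) =
      (EuclideanSpace.basisFun (Fin n) ℝ).toBasis.exteriorPower p s := by
    rw [exteriorPower.basis_apply, exteriorPower.ιMulti_family]
    congr 1
    ext j
    simp
  ext t
  simp only [wedge, LinearMap.compAlternatingMap_apply, h]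
  simp only [LinearEquiv.coe_coe, LinearEquiv.trans_apply,
    WithLp.linearEquiv_symm_apply, PiLp.single_apply]
  simp [Module.Basis.equivFun_apply, Finsupp.single_apply, eq_comm, -exteriorPower.coe_basis]

/-- The `p`-th compound of a set `C` in `ℝⁿ`: the convex hull of the points `x₁ ∧ ⋯ ∧ x_p` with
`x₁, …, x_p ∈ C`. -/
def compoundBody {n : ℕ} (C : Set (EuclideanSpace ℝ (Fin n))) (p : ℕ) :
    Set (EuclideanSpace ℝ (IncTuple n p)) :=
  convexHull ℝ {w | ∃ x : Fin p → EuclideanSpace ℝ (Fin n), (∀ j, x j ∈ C) ∧ wedge n p x = w}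

/-- The `p`-th compound of a lattice `Λ` in `ℝⁿ`: the additive group generated by the points
`x₁ ∧ ⋯ ∧ x_p` with `x₁, …, x_p ∈ Λ`. -/
def compoundLattice {n : ℕ} (Λ : Submodule ℤ (EuclideanSpace ℝ (Fin n))) (p : ℕ) :
    Submodule ℤ (EuclideanSpace ℝ (IncTuple n p)) :=
  Submodule.span ℤ
    {w | ∃ x : Fin p → EuclideanSpace ℝ (Fin n), (∀ j, x j ∈ Λ) ∧ wedge n p x = w}

/-- The product `λ_{i₁}(C, Λ) ⋯ λ_{i_p}(C, Λ)` for the tuple `s = (i₁ < ⋯ < i_p)`. The entries of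
`s` are counted from `0`, the successive minima from `1`. -/
noncomputable def minimaProduct {n p : ℕ} (C : Set (EuclideanSpace ℝ (Fin n)))
    (Λ : Submodule ℤ (EuclideanSpace ℝ (Fin n))) (s : IncTuple n p) : ℝ :=
  ∏ k ∈ (s : Finset (Fin n)), successiveMinimum C Λ ((k : ℕ) + 1)

/-! ### The gauge of a symmetric convex body. -/

namespace IsSymmConvexBody

variable {E : Type*} [NormedAddCommGroup E] [NormedSpace ℝ E] {C : Set E}

/-! Let `v` be independent lattice points attaining the minima `λ_k` of `C`. The wedges of `p` of
the `v k` are independent points of `Λ_p` lying in the matching multiples `μ • C_p`, so the upper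
constant is 1.

For the lower bound, each tuple `s` gives a functional on `ℝ^N`: put the `p` arguments in the slots
of `s`, fill the others with the `v k`, and take the determinant in a basis of `Λ`
(`exists_compound_functionals`). It is integral on `Λ_p`, and on `C_p` it is at most `K ∏_{k ∉ s}
λ_k`, where `K` bounds determinants of vectors of `C`. Among `i` independent points of `r • C_p ∩
Λ_p`, one has a nonzero value, hence at least 1 in absolute value, at some `s` whose product is at
least `μ_i` (`exists_le_apply_ne_zero`). Thus `μ_i ≤ r K ∏ λ_k`.

Finally `K ∏ λ_k` is bounded in terms of `n`: a basis `u` in `C` adapted to the flag of `v` controls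
`K` by `|det u|` (`abs_det_le_of_gauge`), and `|det u| ∏ λ_k` is bounded as in Minkowski's second
theorem (`prod_gauge_mul_det_le`). -/

theorem mem_nhds_zero (hC : IsSymmConvexBody C) : C ∈ nhds (0 : E) := by
  obtain ⟨x, hx⟩ := hC.interior_nonempty
  have hneg : -x ∈ C := hC.neg_mem x (interior_subset hx)
  have h := hC.convex.combo_interior_self_mem_interior hx hneg
    (a := 1 / 2) (b := 1 / 2) (by norm_num) (by norm_num) (by norm_num)
  rw [smul_neg, add_neg_cancel] at h
  exact mem_interior_iff_mem_nhds.mp h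

theorem zero_mem (hC : IsSymmConvexBody C) : (0 : E) ∈ C := mem_of_mem_nhds hC.mem_nhds_zero

theorem absorbent (hC : IsSymmConvexBody C) : Absorbent ℝ C :=
  absorbent_nhds_zero hC.mem_nhds_zero

theorem gauge_add_le (hC : IsSymmConvexBody C) (x y : E) :
    gauge C (x + y) ≤ gauge C x + gauge C y :=
  _root_.gauge_add_le hC.convex hC.absorbent x y

theorem gauge_smul (hC : IsSymmConvexBody C) (t : ℝ) (x : E) :
    gauge C (t • x) = |t| * gauge C x := by
  have hneg := gauge_neg hC.neg_mem
  rcases le_total 0 t with ht | ht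
  · rw [gauge_smul_of_nonneg ht, abs_of_nonneg ht, smul_eq_mul]
  · rw [← hneg, ← neg_smul, gauge_smul_of_nonneg (neg_nonneg.mpr ht), abs_of_nonpos ht,
      smul_eq_mul]

theorem gauge_pos (hC : IsSymmConvexBody C) {x : E} (hx : x ≠ 0) : 0 < gauge C x :=
  (_root_.gauge_pos hC.absorbent
    ((NormedSpace.isVonNBounded_iff ℝ).mpr hC.isCompact.isBounded)).mpr hx

theorem gauge_le_one_iff (hC : IsSymmConvexBody C) {x : E} : gauge C x ≤ 1 ↔ x ∈ C := by
  rw [gauge_le_one_iff_mem_closure hC.convex hC.mem_nhds_zero, hC.isCompact.isClosed.closure_eq]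

theorem gauge_le_iff (hC : IsSymmConvexBody C) {r : ℝ} (hr : 0 ≤ r) {x : E} :
    gauge C x ≤ r ↔ x ∈ r • C := by
  refine ⟨fun h => ?_, gauge_le_of_mem hr⟩
  rcases hr.eq_or_lt with rfl | hr
  · have : x = 0 := by
      by_contra hx
      exact absurd (hC.gauge_pos hx) h.not_gt
    rw [this]
    exact ⟨0, hC.zero_mem, by simp⟩
  · rw [Set.mem_smul_set_iff_inv_smul_mem₀ hr.ne', ← hC.gauge_le_one_iff, hC.gauge_smul,
      abs_of_pos (inv_pos.mpr hr)]
    rwa [inv_mul_le_iff₀ hr, mul_one]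

theorem finite_gauge_le (hC : IsSymmConvexBody C) [FiniteDimensional ℝ E]
    (Λ : Submodule ℤ E) [DiscreteTopology Λ] (r : ℝ) :
    {x : E | x ∈ Λ ∧ gauge C x ≤ r}.Finite := by
  have : ProperSpace E := FiniteDimensional.proper ℝ E
  rcases lt_or_ge r 0 with hr | hr
  · convert Set.finite_empty
    ext x
    simpa using fun _ => hr.trans_le (gauge_nonneg x)
  · have hb : Bornology.IsBounded (r • C) := hC.isCompact.isBounded.smul₀ r
    have hΛ : IsClosed (Λ : Set E) :=
      @AddSubgroup.isClosed_of_discrete _ _ _ _ _ Λ.toAddSubgroup ‹DiscreteTopology Λ›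
    refine (Metric.finite_isBounded_inter_isClosed (s := (Λ : Set E))
      DiscreteTopology.isDiscrete hb hΛ).subset ?_
    rintro x ⟨hx, hxr⟩
    exact ⟨(hC.gauge_le_iff hr).mp hxr, hx⟩

theorem exists_gauge_min (hC : IsSymmConvexBody C) [FiniteDimensional ℝ E]
    (Λ : Submodule ℤ E) [DiscreteTopology Λ] [IsZLattice ℝ Λ] {W : Submodule ℝ E} (hW : W ≠ ⊤) :
    ∃ x ∈ Λ, x ∉ W ∧ ∀ y ∈ Λ, y ∉ W → gauge C x ≤ gauge C y := by
  obtain ⟨z, hz, hzW⟩ : ∃ z ∈ Λ, z ∉ W := by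
    by_contra! h
    refine hW (top_le_iff.mp ?_)
    rw [← IsZLattice.span_top (K := ℝ) (L := Λ)]
    exact Submodule.span_le.mpr h
  obtain ⟨x, ⟨⟨hx, hxz⟩, hxW⟩, hmin⟩ := Set.exists_min_image
    ({x : E | x ∈ Λ ∧ gauge C x ≤ gauge C z} ∩ {x | x ∉ W}) (gauge C)
    ((hC.finite_gauge_le Λ _).inter_of_left _) ⟨z, ⟨hz, le_rfl⟩, hzW⟩
  refine ⟨x, hx, hxW, fun y hy hyW => ?_⟩
  rcases le_total (gauge C y) (gauge C z) with h | h
  · exact hmin y ⟨⟨hy, h⟩, hyW⟩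
  · exact hxz.trans h

end IsSymmConvexBody

/-! ### Lattice points attaining the successive minima. -/

/-- The sequence obtained by applying a choice function to the set of all earlier terms. -/
noncomputable def greedySeq {E : Type*} (F : Set E → E) : ℕ → E
  | k => F (Set.range fun j : Fin k => greedySeq F j)
decreasing_by exact j.2

theorem greedySeq_eq {E : Type*} (F : Set E → E) (k : ℕ) :
    greedySeq F k = F (greedySeq F '' {j | j < k}) := by
  rw [greedySeq]
  congr 1
  ext x
  constructor
  · rintro ⟨j, rfl⟩
    exact ⟨j, j.2, rfl⟩
  · rintro ⟨j, hj, rfl⟩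
    exact ⟨⟨j, hj⟩, rfl⟩

section Minima

variable {E : Type*} [NormedAddCommGroup E] [NormedSpace ℝ E] {C : Set E}

theorem linearIndependent_of_notMem_span_lt {K V : Type*} [Field K] [AddCommGroup V] [Module K V]
    (v : ℕ → V) (n : ℕ) (h : ∀ k < n, v k ∉ Submodule.span K (v '' {j | j < k})) :
    LinearIndependent K (fun k : Fin n => v k) := by
  induction n with
  | zero => exact linearIndependent_empty_type
  | succ n ih =>
    rw [linearIndependent_finSucc']
    refine ⟨ih fun k hk => h k (hk.trans n.lt_succ_self), ?_⟩
    have hrange : v '' {j | j < n} = Set.range fun j : Fin n => v j := by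
      ext x
      constructor
      · rintro ⟨j, hj, rfl⟩
        exact ⟨⟨j, hj⟩, rfl⟩
      · rintro ⟨j, rfl⟩
        exact ⟨j, j.2, rfl⟩
    have hn := h n n.lt_succ_self
    rw [hrange] at hn
    exact hn

/-- Greedy choice: `v k` has least gauge among lattice points outside the span of its predecessors,
and a nonzero coordinate of index at least `k` puts `x` outside that span. The `v k` need not
generate `Λ`. -/
theorem exists_basis_gauge_min [FiniteDimensional ℝ E] (hC : IsSymmConvexBody C) (Λ : Submodule ℤ E)
    [DiscreteTopology Λ] [IsZLattice ℝ Λ] {n : ℕ} (hn : Module.finrank ℝ E = n) :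
    ∃ v : Module.Basis (Fin n) ℝ E, (∀ k, v k ∈ Λ) ∧
      ∀ x ∈ Λ, ∀ k j, k ≤ j → v.repr x j ≠ 0 → gauge C (v k) ≤ gauge C x := by
  classical
  have hF : ∀ S : Set E, ∃ x : E, Submodule.span ℝ S ≠ ⊤ → x ∈ Λ ∧ x ∉ Submodule.span ℝ S ∧
      ∀ y ∈ Λ, y ∉ Submodule.span ℝ S → gauge C x ≤ gauge C y := by
    intro S
    by_cases hS : Submodule.span ℝ S = ⊤
    · exact ⟨0, fun h => absurd hS h⟩
    · obtain ⟨x, h⟩ := hC.exists_gauge_min Λ hS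
      exact ⟨x, fun _ => h⟩
  choose F hF using hF
  set w := greedySeq F
  have hw : ∀ k < n, w k ∈ Λ ∧ w k ∉ Submodule.span ℝ (w '' {j | j < k}) ∧
      ∀ y ∈ Λ, y ∉ Submodule.span ℝ (w '' {j | j < k}) → gauge C (w k) ≤ gauge C y := by
    intro k hk
    have h := hF (w '' {j | j < k}) (fun htop => by
      have h1 := finrank_span_finset_le_card (R := ℝ) ((Finset.range k).image w)
      have h2 : (((Finset.range k).image w : Finset E) : Set E) = w '' {j | j < k} := by
        ext; simp
      rw [h2, Set.finrank, htop, finrank_top, hn] at h1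
      have := Finset.card_image_le (s := Finset.range k) (f := w)
      rw [Finset.card_range] at this
      omega)
    rwa [← greedySeq_eq F k] at h
  have hli := linearIndependent_of_notMem_span_lt (K := ℝ) w n fun k hk => (hw k hk).2.1
  let v : Module.Basis (Fin n) ℝ E :=
    basisOfLinearIndependentOfCardEqFinrank' _ hli (by simp [hn])
  have hv : ∀ k, v k = w k := fun k => by simp [v]
  refine ⟨v, fun k => hv k ▸ (hw k k.2).1, fun x hx k j hkj hxj => ?_⟩
  rw [hv]
  refine (hw k k.2).2.2 x hx fun hmem => hxj ?_
  have hle : Submodule.span ℝ (w '' {j | j < (k : ℕ)}) ≤ LinearMap.ker (v.coord j) := by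
    rw [Submodule.span_le]
    rintro _ ⟨i, hi, rfl⟩
    have hi' : i < (k : ℕ) := hi
    have h1 : w i = v ⟨i, hi'.trans k.2⟩ := (hv ⟨i, hi'.trans k.2⟩).symm
    have h2 : (⟨i, hi'.trans k.2⟩ : Fin n) ≠ j := by
      rintro rfl
      exact absurd hkj (not_le.mpr hi')
    simp [h1, h2]
  exact hle hmem

/-- Of `k + 1` independent vectors, one must leave the `k`-dimensional span of the earlier `v j`, so
its gauge is at least that of `v k`. -/
theorem successiveMinimum_eq_gauge (hC : IsSymmConvexBody C) (Λ : Submodule ℤ E) {n : ℕ}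
    (v : Module.Basis (Fin n) ℝ E) (hv : ∀ k, v k ∈ Λ)
    (hmin : ∀ x ∈ Λ, ∀ k j, k ≤ j → v.repr x j ≠ 0 → gauge C (v k) ≤ gauge C x) (k : Fin n) :
    successiveMinimum C Λ ((k : ℕ) + 1) = gauge C (v k) := by
  have hmem : gauge C (v k) ∈ {r : ℝ | 0 ≤ r ∧ ∃ x : Fin ((k : ℕ) + 1) → E,
      LinearIndependent ℝ x ∧ ∀ j, x j ∈ r • C ∧ x j ∈ Λ} := by
    refine ⟨gauge_nonneg _, fun j => v (Fin.castLE k.2 j),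
      v.linearIndependent.comp _ (Fin.castLE_injective _), fun j => ⟨?_, hv _⟩⟩
    rw [← hC.gauge_le_iff (gauge_nonneg _)]
    refine hmin _ (hv k) _ k ?_ (by simp)
    rw [Fin.le_def]
    exact Nat.le_of_lt_succ j.2
  refine le_antisymm (csInf_le ⟨0, fun r hr => hr.1⟩ hmem) (le_csInf ⟨_, hmem⟩ ?_)
  rintro r ⟨hr, x, hx, hxC⟩
  obtain ⟨i, j, hkj, hij⟩ : ∃ i, ∃ j, k ≤ j ∧ v.repr (x i) j ≠ 0 := by
    by_contra! h
    let f : E →ₗ[ℝ] (Fin (k : ℕ) → ℝ) :=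
      LinearMap.pi fun j => v.coord (Fin.castLE k.2.le j)
    have hdep : ¬ LinearIndependent ℝ (fun i => f (x i)) := fun h' => by
      simpa using h'.fintype_card_le_finrank
    rw [Fintype.not_linearIndependent_iff] at hdep
    obtain ⟨c, hc, i, hi⟩ := hdep
    refine hi (Fintype.linearIndependent_iff.mp hx c ?_ i)
    refine v.ext_elem fun j => ?_
    rcases lt_or_ge j k with hjk | hjk
    · have := congrFun hc ⟨j, hjk⟩
      simpa [f, Finsupp.finsetSum_apply] using this
    · simp [Finsupp.finsetSum_apply, h _ _ hjk]
  exact (hmin _ (hxC i).2 k j hkj hij).trans ((hC.gauge_le_iff hr).mpr (hxC i).1)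

end Minima

/-! ### A basis inside the body, adapted to the flag of `v`. -/

section Flag

variable {E : Type*} [NormedAddCommGroup E] [NormedSpace ℝ E] {C : Set E} {n : ℕ}

/-- By compactness, `u k` maximizes the absolute `k`-th coordinate on the section of `C` by the
`k`-th flag space; homogeneity extends the bound beyond `C`. -/
theorem exists_flag_maximizers (hC : IsSymmConvexBody C) (v : Module.Basis (Fin n) ℝ E) :
    ∃ u : Fin n → E, (∀ k, gauge C (u k) ≤ 1) ∧ (∀ k j, k < j → v.repr (u k) j = 0) ∧
      ∀ k x, (∀ j, k < j → v.repr x j = 0) →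
        |v.repr x k| ≤ gauge C x * |v.repr (u k) k| := by
  have : FiniteDimensional ℝ E := v.finiteDimensional_of_finite
  have hcont : ∀ j, Continuous fun x => v.repr x j := fun j =>
    (v.coord j).continuous_of_finiteDimensional
  have key : ∀ k, ∃ y : E, gauge C y ≤ 1 ∧ (∀ j, k < j → v.repr y j = 0) ∧
      ∀ x, (∀ j, k < j → v.repr x j = 0) → |v.repr x k| ≤ gauge C x * |v.repr y k| := by
    intro k
    have hclosed : IsClosed {x : E | ∀ j, k < j → v.repr x j = 0} := by
      simp only [Set.ofPred_forall]
      exact isClosed_iInter fun j => isClosed_iInter fun _ =>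
        isClosed_eq (hcont j) continuous_const
    obtain ⟨y, ⟨hyC, hy⟩, hmax⟩ := (hC.isCompact.inter_right hclosed).exists_isMaxOn
      ⟨0, hC.zero_mem, by simp⟩ (hcont k).abs.continuousOn
    refine ⟨y, hC.gauge_le_one_iff.mpr hyC, hy, fun x hx => ?_⟩
    rcases eq_or_ne x 0 with rfl | hx0
    · simp
    have hpos := hC.gauge_pos hx0
    have h := hmax (a := (gauge C x)⁻¹ • x) ⟨by
      rw [← hC.gauge_le_one_iff, hC.gauge_smul, abs_of_pos (inv_pos.mpr hpos),
        inv_mul_cancel₀ hpos.ne'], fun j hj => by simp [hx j hj]⟩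
    simp only [Set.mem_ofPred_eq, map_smul, Finsupp.smul_apply, smul_eq_mul, abs_mul,
      abs_of_pos (inv_pos.mpr hpos)] at h
    rwa [inv_mul_le_iff₀ hpos] at h
  choose u h1 h2 h3 using key
  exact ⟨u, h1, h2, h3⟩

/-- Subtracting `t • u k` removes the top `v`-coordinate; maximality gives `|t| ≤ gauge C x`, so the
gauge at most doubles. Iterating down the flag bounds all `u`-coordinates. -/
theorem exists_flag_basis (hC : IsSymmConvexBody C) (v : Module.Basis (Fin n) ℝ E) :
    ∃ u : Module.Basis (Fin n) ℝ E, (∀ k, gauge C (u k) ≤ 1) ∧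
      (∀ k j, k < j → v.repr (u k) j = 0) ∧ (∀ k, v.repr (u k) k ≠ 0) ∧
      ∀ x j, |u.repr x j| ≤ 4 ^ n * gauge C x := by
  obtain ⟨u, hu1, hu2, hu3⟩ := exists_flag_maximizers hC v
  have hne : ∀ k, v.repr (u k) k ≠ 0 := fun k h0 => by
    have := hu3 k (v k) fun j hj => by simp [hj.ne]
    rw [h0] at this
    simp at this
    linarith
  have hdet : IsUnit (v.det u) := by
    rw [v.det_apply, Matrix.det_of_isUpperTriangular, isUnit_iff_ne_zero]
    · exact Finset.prod_ne_zero_iff.mpr fun k _ => by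
        simpa [Module.Basis.toMatrix_apply] using hne k
    · intro i j hij
      simpa [Module.Basis.toMatrix_apply] using hu2 j i hij
  obtain ⟨hli, hsp⟩ := v.is_basis_iff_det.mpr hdet
  let w : Module.Basis (Fin n) ℝ E := Module.Basis.mk hli hsp.ge
  have hw : ∀ k, w k = u k := fun k => by simp [w]
  have key : ∀ m ≤ n, ∀ x, (∀ j : Fin n, m ≤ (j : ℕ) → v.repr x j = 0) →
      ∀ j, |w.repr x j| ≤ 4 ^ m * gauge C x := by
    intro m
    induction m with
    | zero =>
      intro _ x hx j
      have : x = 0 := v.ext_elem fun j => by simpa using hx j (Nat.zero_le _)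
      simp [this]
    | succ m ih =>
      intro hm x hx j
      set k : Fin n := ⟨m, hm⟩
      set t : ℝ := v.repr x k / v.repr (u k) k
      have ht : |t| ≤ gauge C x := by
        rw [abs_div, div_le_iff₀ (abs_pos.mpr (hne k))]
        exact hu3 k x fun j hj => hx j hj
      have hg := gauge_nonneg (s := C) x
      have hy := ih (by omega) (x - t • u k) (fun j hj => by
        rcases hj.eq_or_lt with hj | hj
        · have : j = k := Fin.ext hj.symm
          simp [this, t, hne k]
        · simp [hx j hj, hu2 k j hj]) j
      have hgy : gauge C (x - t • u k) ≤ 2 * gauge C x := by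
        rw [sub_eq_add_neg, ← neg_smul]
        refine (hC.gauge_add_le _ _).trans ?_
        rw [hC.gauge_smul, abs_neg]
        nlinarith [mul_le_mul ht (hu1 k) (gauge_nonneg _) hg]
      have hx' : w.repr x j = w.repr (x - t • u k) j + t * w.repr (w k) j := by
        simp [hw]
      have h1 : |w.repr (w k) j| ≤ 1 := by
        rw [w.repr_self, Finsupp.single_apply]
        split_ifs <;> simp
      calc |w.repr x j| ≤ |w.repr (x - t • u k) j| + |t| * |w.repr (w k) j| := by
            rw [hx', ← abs_mul]; exact abs_add_le _ _
        _ ≤ 4 ^ m * (2 * gauge C x) + gauge C x * 1 := by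
            gcongr
            exact hy.trans (by gcongr)
        _ ≤ 4 ^ (m + 1) * gauge C x := by
            have : (1 : ℝ) ≤ 4 ^ m := one_le_pow₀ (by norm_num)
            rw [pow_succ]
            nlinarith
  refine ⟨w, fun k => hw k ▸ hu1 k, fun k j h => hw k ▸ hu2 k j h, fun k => hw k ▸ hne k,
    fun x => key n le_rfl x fun j hj => absurd j.2 (not_lt.mpr hj)⟩

end Flag

/-! ### Minkowski's theorems and determinant bounds. -/

section Minkowski

open MeasureTheory

theorem exists_ne_zero_mem_box {E : Type*} [NormedAddCommGroup E] [NormedSpace ℝ E]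
    {ι : Type*} [Fintype ι] [DecidableEq ι] (b w : Module.Basis ι ℝ E) (h : 1 < |b.det w|) :
    ∃ x ∈ Submodule.span ℤ (Set.range b), x ≠ 0 ∧ ∀ j, |w.repr x j| ≤ 1 := by
  have : FiniteDimensional ℝ E := b.finiteDimensional_of_finite
  borelize E
  let μ : Measure E := b.addHaar
  let s : Set E := {x | ∀ j, |w.repr x j| ≤ 1}
  -- The fundamental domain of the doubled basis, recentred at the origin, is the half-open box
  -- inside `s`; this yields its volume.
  let w2 := w.isUnitSMul (w := fun _ => (2 : ℝ)) fun _ => isUnit_iff_ne_zero.mpr two_ne_zero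
  have hfund := ZSpan.isAddFundamentalDomain' b μ
  have hsub : (fun x => (∑ j, w j) + x) ⁻¹' ZSpan.fundamentalDomain w2 ⊆ s := by
    intro x hx j
    have hj := hx j
    have : w2.repr (∑ j, w j + x) j = 2⁻¹ * (1 + w.repr x j) := by
      simp [w2, Module.Basis.repr_isUnitSMul, Finsupp.single_apply, Units.smul_def,
        mul_add]
    rw [this] at hj
    rw [abs_le]
    constructor <;> linarith [hj.1, hj.2]
  have hμ0 : μ (ZSpan.fundamentalDomain b) ≠ 0 := ZSpan.measure_fundamentalDomain_ne_zero b
  have hμt : μ (ZSpan.fundamentalDomain b) ≠ ⊤ :=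
    (ZSpan.fundamentalDomain_isBounded b).measure_lt_top.ne
  have hdet : b.det w2 = 2 ^ Fintype.card ι * b.det w := by
    have : (w2 : ι → E) = fun j => (2 : ℝ) • w j := by
      ext j; rw [Module.Basis.isUnitSMul_apply]
    rw [this, b.det.map_smul_univ]
    simp
  have hlt : μ (ZSpan.fundamentalDomain b) * 2 ^ Module.finrank ℝ E < μ s := by
    refine lt_of_lt_of_le ?_ (measure_mono hsub)
    rw [measure_preimage_add, ZSpan.measure_fundamentalDomain w2 μ b, mul_comm,
      Module.finrank_eq_card_basis b, hdet, abs_mul]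
    refine ENNReal.mul_lt_mul_left hμ0 hμt ?_
    rw [abs_of_pos (by positivity), ← ENNReal.ofReal_ofNat, ← ENNReal.ofReal_pow (by norm_num)]
    refine (ENNReal.ofReal_lt_ofReal_iff (by positivity)).mpr ?_
    exact lt_mul_of_one_lt_right (by positivity) h
  have hconv : Convex ℝ s := by
    intro x hx y hy a c ha hc hac j
    have h1 := abs_le.mp (hx j)
    have h2 := abs_le.mp (hy j)
    simp only [map_add, map_smul, Finsupp.add_apply, Finsupp.smul_apply, smul_eq_mul]
    rw [abs_le]
    constructor <;> nlinarith
  have : Countable (Submodule.span ℤ (Set.range b)).toAddSubgroup :=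
    inferInstanceAs (Countable (Submodule.span ℤ (Set.range b)))
  obtain ⟨x, hx0, hxs⟩ := exists_ne_zero_mem_lattice_of_measure_mul_two_pow_lt_measure
    hfund (s := s) (fun x hx j => by simpa using hx j) hconv hlt
  exact ⟨x, x.2, fun h0 => hx0 (Subtype.ext h0), hxs⟩

/-- Otherwise the box with half-axes `λ_k / (2n) • u k` contains a nonzero lattice point `x`. If `k`
is its last nonzero `u`-coordinate, then `x` has gauge at most `λ_k / 2`, yet by triangularity its
`k`-th `v`-coordinate is nonzero, contradicting minimality. -/
theorem prod_gauge_mul_det_le {E : Type*} [NormedAddCommGroup E] [NormedSpace ℝ E] {C : Set E}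
    (hC : IsSymmConvexBody C) (Λ : Submodule ℤ E) {n : ℕ}
    (b v u : Module.Basis (Fin n) ℝ E) (hb : Submodule.span ℤ (Set.range b) = Λ)
    (hv : ∀ k, v k ∈ Λ)
    (hmin : ∀ x ∈ Λ, ∀ k j, k ≤ j → v.repr x j ≠ 0 → gauge C (v k) ≤ gauge C x)
    (hu1 : ∀ k, gauge C (u k) ≤ 1) (hu2 : ∀ k j, k < j → v.repr (u k) j = 0)
    (hu3 : ∀ k, v.repr (u k) k ≠ 0) :
    (∏ k, gauge C (v k)) * |b.det u| ≤ (2 * n) ^ n := by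
  rcases Nat.eq_zero_or_pos n with rfl | hn
  · simp
  have hn' : (0 : ℝ) < 2 * n := by positivity
  have hl : ∀ k, 0 < gauge C (v k) := fun k => hC.gauge_pos (v.ne_zero k)
  by_contra! hlt
  let t : Fin n → ℝ := fun k => gauge C (v k) / (2 * n)
  have ht : ∀ k, 0 < t k := fun k => div_pos (hl k) hn'
  let w := u.isUnitSMul (w := t) fun k => isUnit_iff_ne_zero.mpr (ht k).ne'
  obtain ⟨x, hx, hx0, hxw⟩ := exists_ne_zero_mem_box b w (by
    have : (w : Fin n → E) = fun j => t j • u j := by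
      ext j; rw [Module.Basis.isUnitSMul_apply]
    rw [this, b.det.map_smul_univ, smul_eq_mul, abs_mul,
      abs_of_pos (Finset.prod_pos fun k _ => ht k)]
    simp only [t, Finset.prod_div_distrib, Finset.prod_const, Finset.card_univ, Fintype.card_fin]
    rw [div_mul_eq_mul_div, lt_div_iff₀ (by positivity), one_mul]
    exact hlt)
  rw [hb] at hx
  have hne : (Finset.univ.filter fun j => u.repr x j ≠ 0).Nonempty := by
    by_contra hemp
    refine hx0 (u.ext_elem fun j => ?_)
    have := Finset.not_nonempty_iff_eq_empty.mp hemp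
    simpa using Finset.filter_eq_empty_iff.mp this (Finset.mem_univ j)
  set k := (Finset.univ.filter fun j => u.repr x j ≠ 0).max' hne
  have hk : u.repr x k ≠ 0 := (Finset.mem_filter.mp (Finset.max'_mem _ hne)).2
  have hgt : ∀ j, k < j → u.repr x j = 0 := fun j hj => by
    by_contra h
    exact absurd (Finset.le_max' _ j (by simpa using h)) (not_le.mpr hj)
  have hxk : v.repr x k ≠ 0 := by
    have : v.repr x k = u.repr x k * v.repr (u k) k := by
      conv_lhs => rw [← u.sum_repr x]
      rw [map_sum, Finsupp.finsetSum_apply, Finset.sum_eq_single k]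
      · simp
      · intro j _ hj
        rcases lt_or_gt_of_ne hj with h | h
        · simp [hu2 j k h]
        · simp [hgt j h]
      · simp
    rw [this]
    exact mul_ne_zero hk (hu3 k)
  have hmono : ∀ j, j ≤ k → gauge C (v j) ≤ gauge C (v k) := fun j hj =>
    hmin _ (hv k) j k hj (by simp)
  have hbound : ∀ j, gauge C (u.repr x j • u j) ≤ gauge C (v k) / (2 * n) := by
    intro j
    rcases lt_or_ge k j with h | h
    · rw [hgt j h, zero_smul, gauge_zero]
      exact (div_pos (hl k) hn').le
    · have h1 : |u.repr x j| ≤ t j := by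
        have := hxw j
        simp only [w, Module.Basis.repr_isUnitSMul, Units.smul_def, Units.val_inv_eq_inv_val,
          IsUnit.unit_spec, smul_eq_mul, abs_mul, abs_inv, abs_of_pos (ht j)] at this
        rwa [inv_mul_le_iff₀ (ht j), mul_one] at this
      rw [hC.gauge_smul]
      calc |u.repr x j| * gauge C (u j) ≤ t j * 1 := by
            exact mul_le_mul h1 (hu1 j) (gauge_nonneg _) (ht j).le
        _ ≤ _ := by
            rw [mul_one]
            exact div_le_div_of_nonneg_right (hmono j h) hn'.le
  have hfin : gauge C x ≤ gauge C (v k) / 2 := by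
    conv_lhs => rw [← u.sum_repr x]
    refine (gauge_sum_le hC.convex hC.absorbent _ _).trans ?_
    refine (Finset.sum_le_sum fun j _ => hbound j).trans (le_of_eq ?_)
    rw [Finset.sum_const, Finset.card_univ, Fintype.card_fin, nsmul_eq_mul]
    field_simp
  linarith [hmin x hx k k le_rfl hxk, hl k]

/-- Change basis to `u`, where every matrix entry is at most `4 ^ n`, and expand by Leibniz. -/
theorem abs_det_le_of_gauge {E : Type*} [NormedAddCommGroup E] [NormedSpace ℝ E] {C : Set E}
    {n : ℕ} (b u : Module.Basis (Fin n) ℝ E)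
    (hu : ∀ x j, |u.repr x j| ≤ 4 ^ n * gauge C x) (x : Fin n → E) (hx : ∀ k, gauge C (x k) ≤ 1) :
    |b.det x| ≤ n.factorial * (4 ^ n) ^ n * |b.det u| := by
  have h1 : b.det x = u.det x * b.det u := by
    rw [b.det_apply, u.det_apply, b.det_apply, mul_comm, ← Matrix.det_mul,
      Module.Basis.toMatrix_mul_toMatrix]
  rw [h1, abs_mul, u.det_apply]
  gcongr
  have := Matrix.det_le (A := u.toMatrix x) (abv := AbsoluteValue.abs) (x := (4 : ℝ) ^ n)
    (fun i j => by
      refine (hu (x j) i).trans ?_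
      have : (0 : ℝ) < 4 ^ n := by positivity
      nlinarith [hx j])
  simpa using this

end Minkowski

theorem Function.Embedding.extend_update {M ι κ : Type*} [DecidableEq ι] [DecidableEq κ] (s : κ ↪ ι) (x : κ → M)
    (v : ι → M) (j : κ) (z : M) :
    Function.extend s (Function.update x j z) v =
      Function.update (Function.extend s x v) (s j) z := by
  ext k
  by_cases hk : ∃ i, s i = k
  · obtain ⟨i, rfl⟩ := hk
    rw [s.injective.extend_apply]
    rcases eq_or_ne i j with rfl | hij
    · simp
    · rw [Function.update_of_ne hij, Function.update_of_ne (s.injective.ne hij),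
        s.injective.extend_apply]
  · rw [Function.extend_apply' _ _ _ hk, Function.update_of_ne, Function.extend_apply' _ _ _ hk]
    rintro rfl
    exact hk ⟨j, rfl⟩

/-! ### Functionals on the exterior power and dual pairings. -/

section Fill

variable {R M N ι κ : Type*} [CommRing R] [AddCommGroup M] [Module R M] [AddCommGroup N]
  [Module R N]

/-- The alternating map obtained from `f` by fixing the arguments outside the range of `s`. -/
noncomputable def AlternatingMap.fixOutside (f : M [⋀^ι]→ₗ[R] N) (s : κ ↪ ι) (v : ι → M) :
    M [⋀^κ]→ₗ[R] N where
  toFun x := f (Function.extend s x v)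
  map_update_add' x j y z := by
    classical
    simp only [s.extend_update, f.map_update_add]
  map_update_smul' x j c y := by
    classical
    simp only [s.extend_update, f.map_update_smul]
  map_eq_zero_of_eq' x i j hij hne := by
    refine f.map_eq_zero_of_eq _ (i := s i) (j := s j) ?_ (s.injective.ne hne)
    simpa only [s.injective.extend_apply] using hij

theorem AlternatingMap.fixOutside_apply (f : M [⋀^ι]→ₗ[R] N) (s : κ ↪ ι) (v : ι → M) (x : κ → M) :
    f.fixOutside s v x = f (Function.extend s x v) := rfl

end Fill

theorem exists_linearMap_wedge {n p : ℕ} (f : EuclideanSpace ℝ (Fin n) [⋀^Fin p]→ₗ[ℝ] ℝ) :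
    ∃ φ : EuclideanSpace ℝ (IncTuple n p) →ₗ[ℝ] ℝ, ∀ x, φ (wedge n p x) = f x := by
  refine ⟨exteriorPower.alternatingMapLinearEquiv f ∘ₗ
    (((EuclideanSpace.basisFun (Fin n) ℝ).toBasis.exteriorPower p).equivFun.trans
      (WithLp.linearEquiv 2 ℝ (IncTuple n p → ℝ)).symm).symm.toLinearMap, fun x => ?_⟩
  rw [LinearMap.comp_apply, wedge, LinearMap.compAlternatingMap_apply]
  erw [LinearEquiv.symm_apply_apply]
  exact exteriorPower.alternatingMapLinearEquiv_apply_ιMulti f x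

/-- The `φ s` form a coordinate system, so vectors killed by all `φ (e k)` with `k ≥ i` embed in
`ℝ^i`, which has no room for `i + 1` independent ones. -/
theorem exists_le_apply_ne_zero {V ι : Type*} [AddCommGroup V] [Module ℝ V] {N : ℕ}
    [Fintype ι] (hV : Module.finrank ℝ V = N) [FiniteDimensional ℝ V] [DecidableEq ι]
    (e : Fin N ≃ ι) (φ : ι → V →ₗ[ℝ] ℝ)
    (b : ι → V) (hd : ∀ s, φ s (b s) ≠ 0) (ho : ∀ s t, s ≠ t → φ s (b t) = 0)
    (i : Fin N) (w : Fin ((i : ℕ) + 1) → V) (hw : LinearIndependent ℝ w) :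
    ∃ j k, i ≤ k ∧ φ (e k) (w j) ≠ 0 := by
  by_contra! h
  have hinj : Function.Injective (LinearMap.pi φ) := by
    rw [LinearMap.injective_iff_surjective_of_finrank_eq_finrank
      (by simp [hV, ← Fintype.card_congr e])]
    intro y
    refine ⟨∑ t, (y t / φ t (b t)) • b t, funext fun s => ?_⟩
    rw [LinearMap.pi_apply, map_sum, Finset.sum_eq_single s]
    · simp [hd s]
    · intro t _ ht
      simp [ho s t ht.symm]
    · simp
  let f : V →ₗ[ℝ] (Fin (i : ℕ) → ℝ) := LinearMap.pi fun j => φ (e (Fin.castLE i.2.le j))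
  have hdep : ¬ LinearIndependent ℝ (fun j => f (w j)) := fun h' => by
    simpa using h'.fintype_card_le_finrank
  rw [Fintype.not_linearIndependent_iff] at hdep
  obtain ⟨c, hc, j, hj⟩ := hdep
  refine hj (Fintype.linearIndependent_iff.mp hw c (hinj ?_) j)
  rw [map_zero]
  refine funext fun s => ?_
  obtain ⟨k, rfl⟩ := e.surjective s
  rcases lt_or_ge k i with hk | hk
  · have := congrFun hc ⟨k, hk⟩
    simpa [f] using this
  · simp [h _ _ hk]

theorem linearIndependent_of_dual_pairing {V ι : Type*} [AddCommGroup V] [Module ℝ V] [Fintype ι]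
    (φ : ι → V →ₗ[ℝ] ℝ) (b : ι → V) (hd : ∀ s, φ s (b s) ≠ 0)
    (ho : ∀ s t, s ≠ t → φ s (b t) = 0) : LinearIndependent ℝ b := by
  rw [Fintype.linearIndependent_iff]
  intro c hc s
  have := congrArg (φ s) hc
  rw [map_sum, Finset.sum_eq_single s, map_smul, map_zero, smul_eq_mul] at this
  · exact (mul_eq_zero.mp this).resolve_right (hd s)
  · intro t _ ht
    simp [ho s t ht.symm]
  · simp

/-! ### The compound body and the compound lattice. -/

section Compound

variable {n p : ℕ} {C : Set (EuclideanSpace ℝ (Fin n))} {Λ : Submodule ℤ (EuclideanSpace ℝ (Fin n))}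

/-- The entries of an increasing tuple, as an embedding. -/
def IncTuple.emb (s : IncTuple n p) : Fin p ↪ Fin n :=
  (Set.powersetCard.ofFinEmbEquiv.symm s).toEmbedding

theorem IncTuple.exists_emb_eq_iff (s : IncTuple n p) (k : Fin n) :
    (∃ j, s.emb j = k) ↔ k ∈ (s : Finset (Fin n)) :=
  Set.powersetCard.mem_range_ofFinEmbEquiv_symm_iff_mem s k

theorem IncTuple.prod_emb (s : IncTuple n p) (f : Fin n → ℝ) :
    ∏ j, f (s.emb j) = ∏ k ∈ (s : Finset (Fin n)), f k := by
  rw [← Finset.prod_map Finset.univ s.emb f]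
  congr 1
  ext k
  rw [Finset.mem_map, ← s.exists_emb_eq_iff]
  simp

/-- For `s ≠ t`, some entry `k` of `t` is missing from `s`; then `v k` occurs both as an argument
and as a filler, and the determinant vanishes. -/
theorem exists_compound_functionals (b v : Module.Basis (Fin n) ℝ (EuclideanSpace ℝ (Fin n))) :
    ∃ φ : IncTuple n p → EuclideanSpace ℝ (IncTuple n p) →ₗ[ℝ] ℝ,
      (∀ s x, φ s (wedge n p x) = b.det (Function.extend s.emb x v)) ∧
      (∀ s, φ s (wedge n p (v ∘ s.emb)) ≠ 0) ∧
      ∀ s t, s ≠ t → φ s (wedge n p (v ∘ t.emb)) = 0 := by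
  choose φ hφ using fun s : IncTuple n p => exists_linearMap_wedge (b.det.fixOutside s.emb v)
  refine ⟨φ, hφ, fun s => ?_, fun s t hst => ?_⟩
  · rw [hφ, AlternatingMap.fixOutside_apply]
    have : Function.extend s.emb (v ∘ s.emb) v = v := by
      ext1 k
      by_cases hk : ∃ j, s.emb j = k
      · obtain ⟨j, rfl⟩ := hk
        rw [s.emb.injective.extend_apply, Function.comp_apply]
      · rw [Function.extend_apply' _ _ _ hk]
    rw [this]
    exact (b.isUnit_det v).ne_zero
  · obtain ⟨k, hkt, hks⟩ := (Set.powersetCard.exists_mem_notMem_iff_ne t s).mp hst.symm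
    have hks' : ¬ ∃ j, s.emb j = k := fun h => hks ((s.exists_emb_eq_iff k).mp h)
    obtain ⟨j, hj⟩ := (t.exists_emb_eq_iff k).mpr hkt
    rw [hφ, AlternatingMap.fixOutside_apply]
    refine b.det.map_eq_zero_of_eq _ (i := s.emb j) (j := k) ?_ fun h => hks' ⟨j, h⟩
    rw [s.emb.injective.extend_apply, Function.extend_apply' _ _ _ hks', Function.comp_apply, hj]

theorem exists_int_eq_det {E ι : Type*} [AddCommGroup E] [Module ℝ E] [Fintype ι] [DecidableEq ι]
    (b : Module.Basis ι ℝ E) (x : ι → E)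
    (hx : ∀ k, x k ∈ Submodule.span ℤ (Set.range b)) : ∃ m : ℤ, b.det x = m := by
  choose A hA using fun j i => (b.mem_span_iff_repr_mem ℤ (x j)).mp (hx j) i
  refine ⟨(Matrix.of fun i j => A j i).det, ?_⟩
  rw [b.det_apply, Int.cast_det]
  congr 1
  ext i j
  simpa [Module.Basis.toMatrix_apply] using (hA j i).symm

theorem exists_int_eq_compound_functional
    (b v : Module.Basis (Fin n) ℝ (EuclideanSpace ℝ (Fin n)))
    (hb : Submodule.span ℤ (Set.range b) = Λ) (hv : ∀ k, v k ∈ Λ) {s : IncTuple n p}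
    {φ : EuclideanSpace ℝ (IncTuple n p) →ₗ[ℝ] ℝ}
    (hφ : ∀ x, φ (wedge n p x) = b.det (Function.extend s.emb x v)) {w}
    (hw : w ∈ compoundLattice Λ p) : ∃ m : ℤ, φ w = m := by
  induction hw using Submodule.span_induction with
  | mem w hw =>
    obtain ⟨x, hx, rfl⟩ := hw
    rw [hφ]
    refine exists_int_eq_det b _ fun k => ?_
    rw [hb]
    by_cases hk : ∃ j, s.emb j = k
    · obtain ⟨j, rfl⟩ := hk
      rw [s.emb.injective.extend_apply]
      exact hx j
    · rw [Function.extend_apply' _ _ _ hk]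
      exact hv k
  | zero => exact ⟨0, by simp⟩
  | add x y _ _ hx hy =>
    obtain ⟨k, hk⟩ := hx
    obtain ⟨l, hl⟩ := hy
    exact ⟨k + l, by simp [hk, hl]⟩
  | smul a x _ hx =>
    obtain ⟨k, hk⟩ := hx
    exact ⟨a * k, by rw [map_zsmul, hk]; simp⟩

theorem abs_compound_functional_le (hC : IsSymmConvexBody C)
    (b v : Module.Basis (Fin n) ℝ (EuclideanSpace ℝ (Fin n))) {K : ℝ}
    (hK : ∀ x : Fin n → EuclideanSpace ℝ (Fin n), (∀ k, gauge C (x k) ≤ 1) → |b.det x| ≤ K)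
    {s : IncTuple n p} {φ : EuclideanSpace ℝ (IncTuple n p) →ₗ[ℝ] ℝ}
    (hφ : ∀ x, φ (wedge n p x) = b.det (Function.extend s.emb x v)) {r : ℝ} (hr : 0 ≤ r) {w}
    (hw : w ∈ r • compoundBody C p) :
    |φ w| * ∏ k ∈ (s : Finset (Fin n)), gauge C (v k) ≤ r * (K * ∏ k, gauge C (v k)) := by
  have hl : ∀ k, 0 < gauge C (v k) := fun k => hC.gauge_pos (v.ne_zero k)
  have hP : 0 < ∏ k ∈ (s : Finset (Fin n)), gauge C (v k) := Finset.prod_pos fun k _ => hl k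
  set B := K * ∏ k ∈ (s : Finset (Fin n))ᶜ, gauge C (v k)
  have hsub : compoundBody C p ⊆ φ ⁻¹' Set.Icc (-B) B := by
    refine convexHull_min ?_ ((convex_Icc _ _).linear_preimage φ)
    rintro _ ⟨x, hx, rfl⟩
    rw [Set.mem_preimage, Set.mem_Icc, ← abs_le, hφ]
    -- Normalizing the fillers to gauge 1 makes `hK` applicable and extracts the product over the
    -- complement of `s`.
    have hext : Function.extend s.emb x v = fun k =>
        (if k ∈ (s : Finset (Fin n))ᶜ then gauge C (v k) else 1) •
          Function.extend s.emb x (fun k => (gauge C (v k))⁻¹ • v k) k := by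
      ext1 k
      by_cases hk : ∃ j, s.emb j = k
      · rw [if_neg (by simpa using (s.exists_emb_eq_iff k).mp hk), one_smul]
        obtain ⟨j, rfl⟩ := hk
        rw [s.emb.injective.extend_apply, s.emb.injective.extend_apply]
      · rw [if_pos (by simpa using fun h => hk ((s.exists_emb_eq_iff k).mpr h)),
          Function.extend_apply' _ _ _ hk, Function.extend_apply' _ _ _ hk,
          smul_inv_smul₀ (hl k).ne']
    rw [hext, b.det.map_smul_univ, smul_eq_mul, abs_mul, Finset.prod_ite_mem, Finset.univ_inter,
      abs_of_pos (Finset.prod_pos fun k _ => hl k), mul_comm]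
    refine mul_le_mul_of_nonneg_right (hK _ fun k => ?_) (Finset.prod_pos fun k _ => hl k).le
    by_cases hk : ∃ j, s.emb j = k
    · obtain ⟨j, rfl⟩ := hk
      rw [s.emb.injective.extend_apply]
      exact hC.gauge_le_one_iff.mpr (hx j)
    · rw [Function.extend_apply' _ _ _ hk, hC.gauge_smul, abs_of_pos (inv_pos.mpr (hl k)),
        inv_mul_cancel₀ (hl k).ne']
  obtain ⟨y, hy, rfl⟩ := hw
  have hyB : |φ y| ≤ B := abs_le.mpr (hsub hy)
  have hsplit := Finset.prod_mul_prod_compl (s : Finset (Fin n)) fun k => gauge C (v k)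
  simp only [map_smul, smul_eq_mul, abs_mul, abs_of_nonneg hr]
  calc r * |φ y| * ∏ k ∈ (s : Finset (Fin n)), gauge C (v k)
      ≤ r * B * ∏ k ∈ (s : Finset (Fin n)), gauge C (v k) := by gcongr
    _ = r * (K * ∏ k, gauge C (v k)) := by rw [← hsplit]; ring

theorem wedge_mem_smul_compoundBody (hC : IsSymmConvexBody C) (hp : 1 ≤ p)
    (v : Fin p → EuclideanSpace ℝ (Fin n)) {r : ℝ} (hr : ∏ j, gauge C (v j) ≤ r) :
    wedge n p v ∈ r • compoundBody C p := by
  have hconv : Convex ℝ (compoundBody C p) := convex_convexHull ℝ _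
  -- This needs `1 ≤ p`: a wedge vanishes once some slot is zero.
  have h0 : (0 : EuclideanSpace ℝ (IncTuple n p)) ∈ compoundBody C p :=
    subset_convexHull ℝ _ ⟨fun _ => 0, fun _ => hC.zero_mem,
      (wedge n p).map_coord_zero (⟨0, hp⟩ : Fin p) rfl⟩
  choose x hx hxv using fun j => (hC.gauge_le_iff (gauge_nonneg _)).mp (le_refl (gauge C (v j)))
  have hv : wedge n p v = (∏ j, gauge C (v j)) • wedge n p x := by
    rw [← (wedge n p).map_smul_univ]
    congr 1
    exact funext fun j => (hxv j).symm
  have hmem : wedge n p x ∈ compoundBody C p := subset_convexHull ℝ _ ⟨x, hx, rfl⟩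
  have hP : 0 ≤ ∏ j, gauge C (v j) := Finset.prod_nonneg fun j _ => gauge_nonneg _
  rw [hv]
  rcases (hP.trans hr).eq_or_lt with h | h
  · have : ∏ j, gauge C (v j) = 0 := le_antisymm (hr.trans h.ge) hP
    rw [this, zero_smul]
    exact ⟨0, h0, smul_zero _⟩
  · rw [Set.mem_smul_set_iff_inv_smul_mem₀ h.ne', smul_smul]
    refine hconv.smul_mem_of_zero_mem h0 hmem ⟨by positivity, ?_⟩
    rwa [inv_mul_le_iff₀ h, mul_one]

end Compound

/-! ### Comparison of the minima. -/

theorem theorem3p2 (n p : ℕ) (hn : 2 ≤ n) (hp : 1 ≤ p) (hpn : p ≤ n - 1) :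
    ∃ c₃ c₄ : ℝ, 0 < c₃ ∧ 0 < c₄ ∧
      ∀ (C : Set (EuclideanSpace ℝ (Fin n))), IsSymmConvexBody C →
      ∀ (Λ : Submodule ℤ (EuclideanSpace ℝ (Fin n))) [DiscreteTopology Λ] [IsZLattice ℝ Λ],
      ∀ (e : Fin (n.choose p) ≃ IncTuple n p) (μ : Fin (n.choose p) → ℝ),
        (∀ i, μ i = minimaProduct C Λ (e i)) → Monotone μ →
        ∀ i : Fin (n.choose p),
          c₃ ≤ successiveMinimum (compoundBody C p) (compoundLattice Λ p) ((i : ℕ) + 1) / μ i ∧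
          successiveMinimum (compoundBody C p) (compoundLattice Λ p) ((i : ℕ) + 1) / μ i ≤ c₄ := by
  classical
  -- The determinant bound relative to `|det u|`, times the Minkowski bound for `|det u| ∏ λ_k`.
  set D : ℝ := n.factorial * (4 ^ n) ^ n * (2 * n) ^ n with hD
  have hDpos : 0 < D := by positivity
  refine ⟨D⁻¹, 1, inv_pos.mpr hDpos, one_pos, ?_⟩
  intro C hC Λ _ _ e μ hμ hmono i
  obtain ⟨v, hv, hmin⟩ := exists_basis_gauge_min hC Λ (n := n) (by simp)
  obtain ⟨u, hu1, hu2, hu3, hu4⟩ := exists_flag_basis hC v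
  obtain ⟨b, hb⟩ : ∃ b : Module.Basis (Fin n) ℝ (EuclideanSpace ℝ (Fin n)),
      Submodule.span ℤ (Set.range b) = Λ := by
    have : Module.Finite ℤ Λ := ZLattice.module_finite ℝ Λ
    have : Module.Free ℤ Λ := ZLattice.module_free ℝ Λ
    let b₀ := (Module.finBasisOfFinrankEq ℤ Λ
      ((ZLattice.rank ℝ Λ).trans (by simp : _ = n))).ofZLatticeBasis ℝ Λ
    exact ⟨b₀, Module.Basis.ofZLatticeBasis_span ℝ _ _⟩
  obtain ⟨φ, hφ, hφd, hφo⟩ := exists_compound_functionals (p := p) b v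
  have hl : ∀ k, 0 < gauge C (v k) := fun k => hC.gauge_pos (v.ne_zero k)
  have hμ' : ∀ k, μ k = ∏ j ∈ (e k : Finset (Fin n)), gauge C (v j) := fun k => by
    rw [hμ, minimaProduct]
    exact Finset.prod_congr rfl fun j _ => successiveMinimum_eq_gauge hC Λ v hv hmin j
  have hμpos : ∀ k, 0 < μ k := fun k => by
    rw [hμ']
    exact Finset.prod_pos fun j _ => hl j
  have hmem : μ i ∈ {r : ℝ | 0 ≤ r ∧ ∃ x : Fin ((i : ℕ) + 1) → EuclideanSpace ℝ (IncTuple n p),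
      LinearIndependent ℝ x ∧ ∀ j, x j ∈ r • compoundBody C p ∧ x j ∈ compoundLattice Λ p} := by
    refine ⟨(hμpos i).le, fun j => wedge n p (v ∘ (e (Fin.castLE i.2 j)).emb),
      (linearIndependent_of_dual_pairing φ _ hφd hφo).comp (fun j => e (Fin.castLE i.2 j))
        (e.injective.comp (Fin.castLE_injective _)), fun j => ⟨?_, ?_⟩⟩
    · refine wedge_mem_smul_compoundBody hC hp _ ?_
      refine le_trans (le_of_eq ?_) (hmono (?_ : Fin.castLE i.2 j ≤ i))
      · rw [hμ']
        exact (e (Fin.castLE i.2 j)).prod_emb fun k => gauge C (v k)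
      · rw [Fin.le_def]
        exact Nat.le_of_lt_succ j.2
    · exact Submodule.subset_span ⟨_, fun j => hv _, rfl⟩
  have hK := abs_det_le_of_gauge (C := C) b u hu4
  have hprod := prod_gauge_mul_det_le hC Λ b v u hb hv hmin hu1 hu2 hu3
  constructor
  · rw [le_div_iff₀ (hμpos i)]
    refine le_csInf ⟨_, hmem⟩ ?_
    rintro r ⟨hr, w, hw, hwr⟩
    obtain ⟨j, k, hik, hjk⟩ := exists_le_apply_ne_zero (by
      rw [finrank_euclideanSpace, ← Fintype.card_congr e, Fintype.card_fin]) e φ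
      (fun s => wedge n p (v ∘ s.emb)) hφd hφo i w hw
    obtain ⟨m, hm⟩ := exists_int_eq_compound_functional b v hb hv (hφ (e k)) (hwr j).2
    have h1 : 1 ≤ |φ (e k) (w j)| := by
      rw [hm] at hjk ⊢
      exact_mod_cast Int.one_le_abs (by exact_mod_cast hjk)
    have h2 := abs_compound_functional_le hC b v hK (hφ (e k)) hr (hwr j).1
    rw [← hμ'] at h2
    rw [inv_mul_le_iff₀ hDpos]
    calc μ i ≤ μ k := hmono hik
      _ ≤ |φ (e k) (w j)| * μ k := le_mul_of_one_le_left (hμpos k).le h1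
      _ ≤ _ := h2
      _ = n.factorial * (4 ^ n) ^ n * ((∏ k, gauge C (v k)) * |b.det u|) * r := by ring
      _ ≤ D * r := by
        rw [hD]
        gcongr
  · rw [div_le_one (hμpos i)]
    exact csInf_le ⟨0, fun r hr => hr.1⟩ hmem
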